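/- Let $\kappa$ be a cardinal. A linear order $P$ is *$\kappa$-dense* if $|P|>1$ and $|\{c\in P: a<c<b\}|\ge\kappa$ for all $a<b$ in $P$; it is *$\kappa$-saturated* if $P\neq\emptyset$ and for all (possibly empty) $A,B\subseteq P$ with $|A|,|B|<\kappa$ and $a<b$ for all $a\in A$, $b\in B$, there is $c\in P$ with $a<c<b$ for all $a\in A$, $b\in B$. $P$ is *$\kappa$-scattered* (respectively *weakly $\kappa$-scattered*) if no suborder of $P$ is $\kappa$-dense (respectively $\kappa$-saturated). $P$ is *$\langle\kappa,\mu\rangle$-scattered* if it is the union of fewer than $\mu$ many $\kappa$-scattered suborders. For an ordinal $\alpha$, ${}^{\omega}\alpha$ denotes the set of all functions $\omega\to\alpha$ with the lexicographic order. Let $\kappa$ be a regular uncountable cardinal. Then there is a linear order of size $\kappa$ that is weakly $\kappa$-scattered but not $\langle\kappa,\kappa\rangle$-scattered. Moreover: 1. If $\kappa^{\aleph_0}=\kappa$, then ${}^{\omega}(\kappa^{\omega})$, where $\kappa^\omega$ is ordinal exponentiation, is such a linear order. 2. If $\kappa^{\aleph_0}>\kappa$, then there is an infinite cardinal $\mu<\kappa$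 with $\mu^{\aleph_0}>\kappa$ such that ${}^{\omega}\mu$ has suborders of size $\kappa$, and every suborder of ${}^{\omega}\mu$ of size $\kappa$ is such a linear order. -/

import Mathlib

open Cardinal Ordinal

universe u

namespace GenScattered

/-- A linear order is `κ`-dense if it has more than one point and every open interval
`(a, b)` with `a < b` has at least `κ` elements. -/
def IsDense (κ : Cardinal.{u}) (P : Type u) [LinearOrder P] : Prop :=
  1 < #P ∧ ∀ a b : P, a < b → κ ≤ #(Set.Ioo a b)

/-- A linear order is `κ`-saturated if it is nonempty and for all (possibly empty) subsets
`A < B`, both of size less than `κ`, some point lies strictly between `A` and `B`. -/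
def IsSaturated (κ : Cardinal.{u}) (P : Type u) [LinearOrder P] : Prop :=
  Nonempty P ∧ ∀ A B : Set P, #A < κ → #B < κ → (∀ a ∈ A, ∀ b ∈ B, a < b) →
    ∃ c : P, (∀ a ∈ A, a < c) ∧ ∀ b ∈ B, c < b

/-- `κ`-scattered: no suborder is `κ`-dense. -/
def IsScattered (κ : Cardinal.{u}) (P : Type u) [LinearOrder P] : Prop :=
  ∀ S : Set P, ¬ IsDense κ S

/-- Weakly `κ`-scattered: no suborder is `κ`-saturated. -/
def IsWeaklyScattered (κ : Cardinal.{u}) (P : Type u) [LinearOrder P] : Prop :=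
  ∀ S : Set P, ¬ IsSaturated κ S

/-- `⟨κ, μ⟩`-scattered: the union of fewer than `μ` many `κ`-scattered suborders. -/
def IsPairScattered (κ μ : Cardinal.{u}) (P : Type u) [LinearOrder P] : Prop :=
  ∃ (ι : Type u) (Q : ι → Set P), #ι < μ ∧ (∀ i, IsScattered κ (Q i)) ∧ ⋃ i, Q i = Set.univ

/-- The order `^ω α`: all functions from `ℕ` to the ordinal `α`, ordered lexicographically
(compare values at the least argument where two functions differ). -/
abbrev OmegaPow (α : Ordinal.{u}) : Type u := Lex (ℕ → α.ToType)

end GenScattered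

namespace GenScattered

section

variable {α P : Type u} [LinearOrder α] [LinearOrder P]

/-- The list of the first `n` values of a sequence. -/
def initialValues {α : Type u} (f : Lex (ℕ → α)) (n : ℕ) : List α :=
  (List.range n).map (ofLex f)

theorem initialValues_length {α : Type u} (f : Lex (ℕ → α)) (n : ℕ) :
    (initialValues f n).length = n := by
  simp [initialValues]

theorem initialValues_eq_iff {α : Type u} {f g : Lex (ℕ → α)} {n : ℕ} :
    initialValues f n = initialValues g n ↔ ∀ i < n, ofLex f i = ofLex g i := by
  simp [initialValues, List.map_inj_left]

theorem initialValues_take {α : Type u} (f : Lex (ℕ → α)) {m n : ℕ} (h : m ≤ n) :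
    (initialValues f n).take m = initialValues f m := by
  simp [initialValues, ← List.map_take, List.take_range, h]

theorem lex_lt_iff {f g : Lex (ℕ → α)} :
    f < g ↔ ∃ n, (∀ i < n, ofLex f i = ofLex g i) ∧ ofLex f n < ofLex g n :=
  Iff.rfl

/-- Among a nonempty set of sequences some member has a lexicographically least
initial segment of length `n`. -/
theorem exists_least_initialValues [WellFoundedLT α] {T : Set (Lex (ℕ → α))} (hT : T.Nonempty) (n : ℕ) :
    ∃ c ∈ T, ∀ t ∈ T, c < t ∨ ∀ i < n, ofLex c i = ofLex t i := by
  induction n with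
  | zero =>
    obtain ⟨c, hc⟩ := hT
    exact ⟨c, hc, fun t _ => Or.inr fun i hi => absurd hi (Nat.not_lt_zero i)⟩
  | succ n ih =>
    obtain ⟨c, hc, hmin⟩ := ih
    let V : Set (Lex (ℕ → α)) := {t | t ∈ T ∧ ∀ i < n, ofLex c i = ofLex t i}
    have hV : V.Nonempty := ⟨c, hc, fun _ _ => rfl⟩
    let r : Lex (ℕ → α) → α := fun t => ofLex t n
    have hwf : WellFounded (fun a b : Lex (ℕ → α) => r a < r b) :=
      InvImage.wf r wellFounded_lt
    obtain ⟨d, ⟨hdT, hd⟩, hdmin⟩ := hwf.has_min V hV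
    refine ⟨d, hdT, fun t ht => ?_⟩
    by_cases htc : ∀ i < n, ofLex c i = ofLex t i
    · have hle : ofLex d n ≤ ofLex t n := not_lt.1 (hdmin t ⟨ht, htc⟩)
      have hag : ∀ i < n, ofLex d i = ofLex t i := fun i hi => (hd i hi).symm.trans (htc i hi)
      rcases hle.lt_or_eq with hlt | heq
      · exact Or.inl (lex_lt_iff.2 ⟨n, hag, hlt⟩)
      · refine Or.inr fun i hi => ?_
        rcases Nat.lt_succ_iff_lt_or_eq.1 hi with h | rfl
        · exact hag i h
        · exact heq
    · left
      obtain ⟨k, hk, hlt⟩ := lex_lt_iff.1 ((hmin t ht).resolve_right htc)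
      have hkn : k < n := by
        by_contra hkn
        exact htc fun i hi => hk i (hi.trans_le (not_lt.1 hkn))
      refine lex_lt_iff.2 ⟨k, fun i hi => ?_, ?_⟩
      · rw [← hd i (hi.trans hkn), hk i hi]
      · rwa [← hd k hkn]

theorem exists_countable_coinitial_lex [WellFoundedLT α] (T : Set (Lex (ℕ → α))) :
    ∃ C ⊆ T, C.Countable ∧ ∀ t ∈ T, ∃ c ∈ C, c ≤ t := by
  rcases T.eq_empty_or_nonempty with rfl | hT
  · exact ⟨∅, subset_rfl, Set.countable_empty, by simp⟩
  choose c hcT hc using exists_least_initialValues hT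
  let D : Set (Lex (ℕ → α)) := {t | t ∈ T ∧ ∀ n, ∀ i < n, ofLex (c n) i = ofLex t i}
  have hD : D.Subsingleton := fun s hs t ht => by
    refine ofLex.injective (funext fun i => ?_)
    rw [← hs.2 (i + 1) i i.lt_succ_self, ht.2 (i + 1) i i.lt_succ_self]
  refine ⟨Set.range c ∪ D, ?_, (Set.countable_range c).union hD.countable, fun t ht => ?_⟩
  · rintro t (⟨n, rfl⟩ | ht)
    exacts [hcT n, ht.1]
  · by_cases h : ∃ n, c n < t
    · obtain ⟨n, hn⟩ := h
      exact ⟨c n, Or.inl ⟨n, rfl⟩, hn.le⟩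
    · push Not at h
      exact ⟨t, Or.inr ⟨ht, fun n => (hc n t ht).resolve_left (h n)⟩, le_rfl⟩

theorem exists_countable_coinitial [WellFoundedLT α] (e : P ↪o Lex (ℕ → α)) (T : Set P) :
    ∃ C ⊆ T, C.Countable ∧ ∀ t ∈ T, ∃ c ∈ C, c ≤ t := by
  obtain ⟨C, hCT, hC, h⟩ := exists_countable_coinitial_lex (e '' T)
  refine ⟨e ⁻¹' C, fun p hp => ?_, hC.preimage e.injective, fun t ht => ?_⟩
  · obtain ⟨q, hq, hqp⟩ := hCT hp
    rwa [← e.injective hqp]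
  · obtain ⟨c, hc, hct⟩ := h (e t) ⟨t, ht, rfl⟩
    obtain ⟨q, -, rfl⟩ := hCT hc
    exact ⟨q, hc, e.le_iff_le.1 hct⟩

theorem isWeaklyScattered_of_orderEmbedding [WellFoundedLT α] {κ : Cardinal.{u}} (hunc : ℵ₀ < κ)
    (e : P ↪o Lex (ℕ → α)) : IsWeaklyScattered κ P := by
  rintro S ⟨-, hS⟩
  obtain ⟨C, -, hC, h⟩ :=
    exists_countable_coinitial ((OrderEmbedding.subtype (· ∈ S)).trans e) Set.univ
  obtain ⟨c, -, hc⟩ := hS ∅ C (by rw [mk_eq_zero]; exact aleph0_pos.trans hunc)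
    ((le_aleph0_iff_set_countable.2 hC).trans_lt hunc) (by simp)
  obtain ⟨b, hb, hbc⟩ := h c trivial
  exact (hc b hb).not_ge hbc

/-- A `κ`-complete ideal of subsets of a suborder of `^ω α` containing all singletons and
closed under unions indexed by finite sequences `s` of sets all of whose members extend `s`. -/
structure IsNormalIdeal (κ : Cardinal.{u}) (e : P ↪o Lex (ℕ → α)) (I : Set P → Prop) : Prop where
  mono : ∀ {A B : Set P}, A ⊆ B → I B → I A
  iUnion : ∀ {ι : Type u} (A : ι → Set P), #ι < κ → (∀ i, I (A i)) → I (⋃ i, A i)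
  singleton : ∀ p, I {p}
  normal : ∀ A : List α → Set P, (∀ s, I (A s)) →
    (∀ s, ∀ p ∈ A s, ∃ n, initialValues (e p) n = s) → I (⋃ s, A s)

namespace IsNormalIdeal

variable {κ : Cardinal.{u}} {e : P ↪o Lex (ℕ → α)} {I : Set P → Prop}

theorem of_card_lt (hI : IsNormalIdeal κ e I) {A : Set P} (hA : #A < κ) : I A :=
  hI.mono (fun p hp => Set.mem_iUnion.2 ⟨⟨p, hp⟩, rfl⟩)
    (hI.iUnion (fun a : A => {a.1}) hA fun a => hI.singleton a)

theorem union (hI : IsNormalIdeal κ e I) (hunc : ℵ₀ < κ) {A B : Set P} (hA : I A) (hB : I B) :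
    I (A ∪ B) := by
  refine hI.mono ?_ (hI.iUnion (fun b : ULift.{u} Bool => bif b.down then A else B)
    ((mk_le_aleph0 (α := ULift.{u} Bool)).trans_lt hunc) ?_)
  · rintro p (hp | hp)
    · exact Set.mem_iUnion.2 ⟨⟨true⟩, hp⟩
    · exact Set.mem_iUnion.2 ⟨⟨false⟩, hp⟩
  · rintro ⟨_ | _⟩
    exacts [hB, hA]

theorem diff (hI : IsNormalIdeal κ e I) (hunc : ℵ₀ < κ) {A B : Set P} (hA : ¬ I A) (hB : I B) :
    ¬ I (A \ B) := fun h =>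
  hA (hI.mono (by rw [Set.sdiff_union_self]; exact Set.subset_union_left) (hI.union hunc h hB))

/-- The members of `Q` above `p` agreeing with `p` on the first `n` coordinates. -/
def above (e : P ↪o Lex (ℕ → α)) (Q : Set P) (p : P) (n : ℕ) : Set P :=
  {q | q ∈ Q ∧ p < q ∧ initialValues (e q) n = initialValues (e p) n}

theorem setOf_above [WellFoundedLT α] (hI : IsNormalIdeal κ e I) (hunc : ℵ₀ < κ) (Q : Set P) :
    I {p | p ∈ Q ∧ ∃ n, I (above e Q p n)} := by
  let B : List α → Set P := fun s =>
    {p | p ∈ Q ∧ ∃ n, initialValues (e p) n = s ∧ I (above e Q p n)}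
  refine hI.mono ?_ (hI.normal B (fun s => ?_) fun s p hp => hp.2.imp fun n hn => hn.1)
  · rintro p ⟨hp, n, hn⟩
    exact Set.mem_iUnion.2 ⟨initialValues (e p) n, hp, n, rfl, hn⟩
  · obtain ⟨C, hCB, hC, hco⟩ := exists_countable_coinitial e (B s)
    have hCκ : #C < κ := (le_aleph0_iff_set_countable.2 hC).trans_lt hunc
    refine hI.mono ?_ (hI.union hunc (hI.of_card_lt hCκ)
      (hI.iUnion (fun c : C => above e Q c s.length) hCκ fun c => ?_))
    · rintro p ⟨hpQ, n, rfl, hn⟩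
      obtain ⟨c, hc, hcp⟩ := hco p ⟨hpQ, n, rfl, hn⟩
      rcases hcp.eq_or_lt with rfl | hlt
      · exact Or.inl hc
      · refine Or.inr (Set.mem_iUnion.2 ⟨⟨c, hc⟩, hpQ, hlt, ?_⟩)
        obtain ⟨-, m, hm, -⟩ := hCB hc
        have hmn : m = n := by
          simpa [initialValues_length] using congrArg List.length hm
        subst hmn
        rw [initialValues_length, hm]
    · obtain ⟨-, m, hm, hIm⟩ := hCB c.2
      have hms : m = s.length := by rw [← hm, initialValues_length]
      rwa [← hms]

theorem not_isScattered [WellFoundedLT α] (hI : IsNormalIdeal κ e I) (hunc : ℵ₀ < κ) {Q : Set P} (hQ : ¬ I Q) :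
    ¬ IsScattered κ Q := by
  let B : Set P := {p | p ∈ Q ∧ ∃ n, I (above e Q p n)}
  have hB : I B := hI.setOf_above hunc Q
  have large : ∀ {A : Set P}, ¬ I A → κ ≤ #A := fun hA =>
    not_lt.1 fun h => hA (hI.of_card_lt h)
  let S : Set Q := {p | (p : P) ∉ B}
  intro h
  refine h S ⟨?_, fun a b hab => ?_⟩
  · have hle : κ ≤ #↑(Q \ B) := large (hI.diff hunc hQ hB)
    refine (one_lt_aleph0.trans hunc).trans_le (hle.trans ?_)
    exact mk_le_of_injective (f := fun p : ↑(Q \ B) => (⟨⟨p.1, p.2.1⟩, p.2.2⟩ : S))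
      fun p q hpq => Subtype.ext (congrArg (fun x : S => (x.1 : P)) hpq)
  · have hlt : e (a.1 : P) < e (b.1 : P) := e.lt_iff_lt.2 hab
    obtain ⟨n, hn, hnlt⟩ := lex_lt_iff.1 hlt
    have hU : ¬ I (above e Q a.1 (n + 1)) := fun hU => a.2 ⟨a.1.2, n + 1, hU⟩
    refine (large (hI.diff hunc hU hB)).trans ?_
    have key : ∀ p ∈ above e Q a.1 (n + 1), p < b.1 := fun p hp => by
      have hag := initialValues_eq_iff.1 hp.2.2
      refine e.lt_iff_lt.1 (lex_lt_iff.2 ⟨n, fun i hi => ?_, ?_⟩)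
      · rw [hag i (hi.trans n.lt_succ_self), hn i hi]
      · rwa [hag n n.lt_succ_self]
    exact mk_le_of_injective
      (f := fun p : ↑(above e Q a.1 (n + 1) \ B) =>
        (⟨⟨⟨p.1, p.2.1.1⟩, p.2.2⟩, p.2.1.2.1, key p.1 p.2.1⟩ : Set.Ioo a b))
      fun p q hpq => Subtype.ext (congrArg (fun x : Set.Ioo a b => (x.1.1 : P)) hpq)

theorem not_isPairScattered [WellFoundedLT α] (hI : IsNormalIdeal κ e I) (hunc : ℵ₀ < κ) (huniv : ¬ I Set.univ) :
    ¬ IsPairScattered κ κ P := by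
  rintro ⟨ι, Q, hι, hQ, hcover⟩
  refine huniv (hcover ▸ hI.iUnion Q hι fun i => ?_)
  by_contra hi
  exact hI.not_isScattered hunc hi (hQ i)

end IsNormalIdeal

theorem isNormalIdeal_card_lt {κ : Cardinal.{u}} (hκ : κ.IsRegular) (hunc : ℵ₀ < κ) (hα : #α < κ)
    (e : P ↪o Lex (ℕ → α)) : IsNormalIdeal κ e fun A => #A < κ where
  mono h hB := (mk_le_mk_of_subset h).trans_lt hB
  iUnion A hι hA := (card_iUnion_lt_iff_forall_of_isRegular hκ hι).2 hA
  singleton p := by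
    rw [mk_singleton]
    exact one_lt_aleph0.trans hunc
  normal A hA _ := (card_iUnion_lt_iff_forall_of_isRegular hκ
    ((mk_list_le_max α).trans_lt (max_lt hunc hα))).2 hA

/-- A set of sequences of ordinals is `κ`-thin if some function `F` from finite sequences to `κ`
bounds every sequence below `κ` in the set by the value of `F` at one of its initial segments. -/
def IsThin (κ : Cardinal.{u}) {o : Ordinal.{u}} (A : Set (OmegaPow o)) : Prop :=
  ∃ F : List o.ToType → Ordinal.{u}, (∀ s, F s < κ.ord) ∧
    ∀ f ∈ A, (∀ m, (ofLex f m).toOrd.1 < κ.ord) →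
      ∃ n, ∀ m, (ofLex f m).toOrd.1 < F (initialValues f n)

theorem isNormalIdeal_isThin {κ : Cardinal.{u}} (hκ : κ.IsRegular) (hunc : ℵ₀ < κ)
    (o : Ordinal.{u}) :
    IsNormalIdeal κ (RelEmbedding.refl _ : OmegaPow o ↪o OmegaPow o) (IsThin κ) where
  mono := fun h ⟨F, hF, hB⟩ => ⟨F, hF, fun f hf => hB f (h hf)⟩
  iUnion := fun {ι} A hι hA => by
    choose F hF h using hA
    refine ⟨fun s => ⨆ i, F i s, fun s => ?_, fun f hf hfκ => ?_⟩
    · exact iSup_lt_of_lt_cof (by rwa [hκ.cof_ord]) fun i => hF i s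
    · obtain ⟨i, hi⟩ := Set.mem_iUnion.1 hf
      obtain ⟨n, hn⟩ := h i f hi hfκ
      exact ⟨n, fun m => (hn m).trans_le (Ordinal.le_iSup (fun i => F i _) i)⟩
  singleton := fun f => by
    by_cases hf : ∀ m, (ofLex f m).toOrd.1 < κ.ord
    · have hlim := isSuccLimit_ord hκ.aleph0_le
      refine ⟨fun _ => ⨆ m, Order.succ (ofLex f m).toOrd.1, fun _ => ?_, ?_⟩
      · refine lift_iSup_lt_of_lt_cof ?_ fun m => hlim.succ_lt (hf m)
        simpa [hκ.cof_ord] using hunc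
      · intro g hg _
        rw [Set.mem_singleton_iff.1 hg]
        exact ⟨0, fun m => (Order.lt_succ _).trans_le
          (Ordinal.le_iSup (fun m => Order.succ (ofLex f m).toOrd.1) m)⟩
    · refine ⟨fun _ => 0, fun _ => hκ.ord_pos, ?_⟩
      intro g hg h
      exact absurd (Set.mem_singleton_iff.1 hg ▸ h) hf
  normal := fun A hA hext => by
    choose F hF h using hA
    refine ⟨fun s => ⨆ ij : ℕ × ℕ, F (s.take ij.1) (s.take ij.2), fun s => ?_,
      fun f hf hfκ => ?_⟩
    · refine lift_iSup_lt_of_lt_cof ?_ fun _ => hF _ _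
      simpa [hκ.cof_ord] using hunc
    · obtain ⟨s, hs⟩ := Set.mem_iUnion.1 hf
      obtain ⟨n, hn⟩ := h s f hs hfκ
      obtain ⟨k, rfl⟩ := hext s f hs
      refine ⟨max k n, fun m => (hn m).trans_le ?_⟩
      have hle := Ordinal.le_iSup (fun ij : ℕ × ℕ => F ((initialValues f (max k n)).take ij.1)
        ((initialValues f (max k n)).take ij.2)) (k, n)
      simp only [initialValues_take f (le_max_left k n),
        initialValues_take f (le_max_right k n)] at hle
      exact hle

theorem not_isThin_univ {κ : Cardinal.{u}} {o : Ordinal.{u}} (ho : κ.ord ≤ o) :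
    ¬ IsThin κ (Set.univ : Set (OmegaPow o)) := by
  rintro ⟨F, hF, h⟩
  let v : List o.ToType → o.ToType := fun s => ToType.mk ⟨F s, (hF s).trans_le ho⟩
  let t : ℕ → List o.ToType := fun n => n.rec [] fun _ s => s ++ [v s]
  let f : OmegaPow o := toLex fun n => v (t n)
  have ht : ∀ n, initialValues f n = t n := by
    intro n
    induction n with
    | zero => rfl
    | succ n ih =>
      have : initialValues f (n + 1) = initialValues f n ++ [v (t n)] := by
        simp [initialValues, List.range_succ, f]
      rw [this, ih]
  have hv : ∀ n, (ofLex f n).toOrd.1 = F (t n) := fun n => by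
    simp [f, v]
  obtain ⟨n, hn⟩ := h f trivial fun m => (hv m).trans_lt (hF _)
  exact ((hn n).trans_eq (by rw [ht n])).ne (hv n)

end

theorem exists_lt_lt_power_aleph0 {κ : Cardinal.{u}} (hκ : κ.IsRegular) (hunc : ℵ₀ < κ)
    (h : κ < κ ^ ℵ₀) : ∃ μ : Cardinal.{u}, ℵ₀ ≤ μ ∧ μ < κ ∧ κ < μ ^ ℵ₀ := by
  suffices ∃ μ < κ, κ < μ ^ ℵ₀ by
    obtain ⟨μ, hμ, hlt⟩ := this
    exact ⟨max ℵ₀ μ, le_max_left _ _, max_lt hunc hμ,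
      hlt.trans_le (power_le_power_right (le_max_right _ _))⟩
  by_contra! hle
  refine h.not_ge ?_
  let X := κ.ord.ToType
  have hX : #X = κ := mk_ord_toType κ
  have hbdd : ∀ f : ℕ → X, ∃ x, ∀ n, f n < x := fun f => by
    have hlim := isSuccLimit_ord hκ.aleph0_le
    have hlt : ⨆ n, Order.succ (f n).toOrd.1 < κ.ord := by
      refine lift_iSup_lt_of_lt_cof ?_ fun n => hlim.succ_lt (f n).toOrd.2
      simpa [hκ.cof_ord] using hunc
    refine ⟨ToType.mk ⟨_, hlt⟩, fun n => ?_⟩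
    rw [← ToType.mk.symm.lt_iff_lt, OrderIso.symm_apply_apply, ← Subtype.coe_lt_coe]
    exact (Order.lt_succ (f n).toOrd.1).trans_le (Ordinal.le_iSup (fun n => Order.succ (f n).toOrd.1) n)
  choose b hb using hbdd
  calc κ ^ ℵ₀ = #(ℕ → X) := by simp [hX]
    _ ≤ #(Σ x : X, ℕ → Set.Iio x) := mk_le_of_injective
      (f := fun f => (⟨b f, fun n => ⟨f n, hb f n⟩⟩ : Σ x : X, ℕ → Set.Iio x)) (by
        have hval : ∀ p q : Σ x : X, ℕ → Set.Iio x, p = q →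
            ∀ n, ((p.2 n : X)) = (q.2 n : X) := by
          rintro p _ rfl n
          rfl
        exact fun f g hfg => funext (hval _ _ hfg))
    _ = Cardinal.sum fun x : X => #(Set.Iio x) ^ ℵ₀ := by simp [mk_sigma]
    _ ≤ Cardinal.sum fun _ : X => κ :=
      Cardinal.sum_le_sum _ _ fun x => hle _ (by
        simpa only [hX] using mk_Iio_lt x (by rw [hX, type_toType]))
    _ = κ := by rw [sum_const', hX, mul_eq_self hκ.aleph0_le]

theorem mk_omegaPow (o : Ordinal.{u}) : #(OmegaPow o) = o.card ^ ℵ₀ := by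
  change #(ℕ → o.ToType) = _
  simp

theorem omegaPow_opow_omega0 {κ : Cardinal.{u}} (hκ : κ.IsRegular) (hunc : ℵ₀ < κ)
    (h : κ ^ ℵ₀ = κ) :
    #(OmegaPow (κ.ord ^ ω)) = κ ∧ IsWeaklyScattered κ (OmegaPow (κ.ord ^ ω)) ∧
      ¬ IsPairScattered κ κ (OmegaPow (κ.ord ^ ω)) := by
  refine ⟨?_, isWeaklyScattered_of_orderEmbedding hunc (RelEmbedding.refl _),
    (isNormalIdeal_isThin hκ hunc _).not_isPairScattered hunc
      (not_isThin_univ (left_le_opow _ omega0_pos))⟩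
  have hone : 1 < κ.ord := by
    rw [← ord_one, ord_lt_ord]
    exact one_lt_aleph0.trans hunc
  rw [mk_omegaPow, card_opow_omega0 hone, card_ord, max_eq_right hunc.le, h]

theorem omegaPow_suborder {κ μ : Cardinal.{u}} (hκ : κ.IsRegular) (hunc : ℵ₀ < κ) (hμ : μ < κ)
    (P : Set (OmegaPow μ.ord)) (hP : #P = κ) :
    IsWeaklyScattered κ P ∧ ¬ IsPairScattered κ κ P := by
  let e : P ↪o OmegaPow μ.ord := OrderEmbedding.subtype (· ∈ P)
  refine ⟨isWeaklyScattered_of_orderEmbedding hunc e,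
    (isNormalIdeal_card_lt hκ hunc (by rwa [mk_ord_toType]) e).not_isPairScattered hunc ?_⟩
  rw [mk_univ, hP]
  exact lt_irrefl κ

end GenScattered

theorem mainTheorem9 (κ : Cardinal.{u}) (hκ : κ.IsRegular) (hunc : ℵ₀ < κ) :
    (∃ (P : Type u) (_ : LinearOrder P), #P = κ ∧
      GenScattered.IsWeaklyScattered κ P ∧ ¬ GenScattered.IsPairScattered κ κ P) ∧
    (κ ^ ℵ₀ = κ →
      #(GenScattered.OmegaPow (κ.ord ^ ω)) = κ ∧
      GenScattered.IsWeaklyScattered κ (GenScattered.OmegaPow (κ.ord ^ ω)) ∧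
      ¬ GenScattered.IsPairScattered κ κ (GenScattered.OmegaPow (κ.ord ^ ω))) ∧
    (κ < κ ^ ℵ₀ →
      ∃ μ : Cardinal.{u}, ℵ₀ ≤ μ ∧ μ < κ ∧ κ < μ ^ ℵ₀ ∧
        (∃ P : Set (GenScattered.OmegaPow μ.ord), #P = κ) ∧
        ∀ P : Set (GenScattered.OmegaPow μ.ord), #P = κ →
          GenScattered.IsWeaklyScattered κ P ∧ ¬ GenScattered.IsPairScattered κ κ P) := by
  have hsmall : κ < κ ^ ℵ₀ →
      ∃ μ : Cardinal.{u}, ℵ₀ ≤ μ ∧ μ < κ ∧ κ < μ ^ ℵ₀ ∧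
        (∃ P : Set (GenScattered.OmegaPow μ.ord), #P = κ) ∧
        ∀ P : Set (GenScattered.OmegaPow μ.ord), #P = κ →
          GenScattered.IsWeaklyScattered κ P ∧ ¬ GenScattered.IsPairScattered κ κ P := by
    intro h
    obtain ⟨μ, hμ, hμκ, hlt⟩ := GenScattered.exists_lt_lt_power_aleph0 hκ hunc h
    refine ⟨μ, hμ, hμκ, hlt, ?_, GenScattered.omegaPow_suborder hκ hunc hμκ⟩
    exact le_mk_iff_exists_set.1 (by rw [GenScattered.mk_omegaPow, card_ord]; exact hlt.le)
  refine ⟨?_, GenScattered.omegaPow_opow_omega0 hκ hunc, hsmall⟩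
  rcases (self_le_power κ one_le_aleph0).eq_or_lt with h | h
  · exact ⟨_, inferInstance, GenScattered.omegaPow_opow_omega0 hκ hunc h.symm⟩
  · obtain ⟨μ, -, -, -, ⟨P, hP⟩, hall⟩ := hsmall h
    exact ⟨P, inferInstance, hP, hall P hP⟩
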